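/- There are a function $N:\mathbb N\to\mathbb N$ and, for every integer $n\ge 1$, a planar graph $G_n$ on exactly $N(n)$ vertices that contains every $n$-vertex outerplanar graph as a (not necessarily induced) subgraph, such that $N(n)\le n^{2\log_2 n}$ for every $n\ge 1$, and $N(n)=n^{f(n)}$ for every $n\ge 1$ with a function $f:\mathbb N\to\mathbb R$ satisfying $f(n)=\Theta(\log n)$ as $n\to\infty$. Here graphs are finite and simple; a graph is planar if it can be drawn in the plane without crossings (vertices are distinct points, edges are simple arcs joining their end vertices, and distinct edges meet only in common end vertices), and it is outerplanar if it has such a drawing inside a closed disc with all vertices on the boundary circle of the disc. -/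

import Mathlib

open Filter Asymptotics

/-- A drawing of the graph `G` in the Euclidean plane (modelled by `ℂ`) without crossings: distinct
vertices are distinct points, an edge is a simple arc joining the points of its two end vertices,
no arc passes through a vertex in its interior, and two different arcs meet only in vertices. -/
structure PlaneDrawing {V : Type*} (G : SimpleGraph V) where
  pt : V → ℂ
  pt_injective : Function.Injective pt
  arc : G.edgeSet → C(unitInterval, ℂ)
  arc_injective : ∀ e, Function.Injective (arc e)
  arc_ends : ∀ e : G.edgeSet, s(arc e 0, arc e 1) = Sym2.map pt (e : Sym2 V)
  arc_avoids : ∀ (e : G.edgeSet) (t : unitInterval) (v : V), arc e t = pt v → t = 0 ∨ t = 1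
  arcs_disjoint : ∀ (e e' : G.edgeSet) (t t' : unitInterval), e ≠ e' → arc e t = arc e' t' →
    ∃ v, arc e t = pt v

/-- A graph is planar if it can be drawn in the plane without crossings. -/
def IsPlanar {V : Type*} (G : SimpleGraph V) : Prop :=
  Nonempty (PlaneDrawing G)

/-- A graph is outerplanar if it can be drawn without crossings in a closed disc in such a way that
all its vertices lie on the boundary circle of the disc. -/
def IsOuterplanar {V : Type*} (G : SimpleGraph V) : Prop :=
  ∃ D : PlaneDrawing G,
    (∀ v, D.pt v ∈ Metric.sphere (0 : ℂ) 1) ∧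
    ∀ e t, D.arc e t ∈ Metric.closedBall (0 : ℂ) 1

/-! In the order of its vertices along the circle an outerplanar graph has no interlacing edges
(`IsOuterplanar.exists_noncrossing`). Hence it lies in a triangulated polygon, coded by a binary
tree with n - 2 nodes over a root edge (`BinTree.exists_of_noncrossing`). It remains to find one
planar graph containing all these polygons; it arises from a triangle by repeatedly inserting the
centroid of a face (`Stacking`), which keeps a straight-line drawing free of crossings.

After a reflection the right subtree at the root is the larger one, so the left one has at most half
of the vertices. Descending into larger subtrees, one meets runs of triangles around a common
vertex; a run ends when the larger subtree changes sides, and the next run turns around the last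
apex. A `spine` supplies these turning points, a `fan` the other vertices of a run, and the smaller
subtrees go into copies, attached to the edges in both orientations, of the same construction for
half the size (`realizeIn_fan`, `isRightHeavyUniversal_spine`).

A spine of length k with copies of L has k²(1 + 2|L|) vertices, so the size U satisfies U(m + 1) = 1
+ 2(m + 1)² U(⌊m/2⌋). About log₂ n halvings, each costing a polynomial factor, give n to a power of
order log n, from above (`count_universal_le`) and from below (`le_count_universal`). -/

/-! ### Interlaced curves in the disc and noncrossing vertex orders. -/

theorem Complex.arg_one_sub_exp_mul_I {φ : ℝ} (h0 : 0 < φ) (h1 : φ < 2 * Real.pi) :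
    Complex.arg (1 - Complex.exp (φ * Complex.I)) = (φ - Real.pi) / 2 := by
  have hs : 0 < 2 * Real.sin (φ / 2) := by
    have := Real.sin_pos_of_pos_of_lt_pi (x := φ / 2) (by linarith) (by linarith)
    linarith
  -- The inscribed angle theorem: the chord turns at half the speed of its end point.
  have key : 1 - Complex.exp (φ * Complex.I) = (2 * Real.sin (φ / 2) : ℝ) *
      (Complex.cos (((φ - Real.pi) / 2 : ℝ)) + Complex.sin (((φ - Real.pi) / 2 : ℝ)) *
        Complex.I) := by
    have hc : Real.cos ((φ - Real.pi) / 2) = Real.sin (φ / 2) := by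
      rw [sub_div, Real.cos_sub_pi_div_two]
    have hsn : Real.sin ((φ - Real.pi) / 2) = - Real.cos (φ / 2) := by
      rw [sub_div, Real.sin_sub_pi_div_two]
    rw [← Complex.ofReal_cos, ← Complex.ofReal_sin, hc, hsn, Complex.exp_mul_I,
      ← Complex.ofReal_cos, ← Complex.ofReal_sin]
    have e : φ = 2 * (φ / 2) := by ring
    have e1 : Real.cos φ = 1 - 2 * Real.sin (φ / 2) ^ 2 := by
      rw [e, Real.cos_two_mul, ← e]; nlinarith [Real.sin_sq_add_cos_sq (φ / 2)]
    have e2 : Real.sin φ = 2 * Real.sin (φ / 2) * Real.cos (φ / 2) := by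
      conv_lhs => rw [e]
      exact Real.sin_two_mul _
    rw [e1, e2]
    push_cast
    ring
  rw [key, Complex.arg_mul_cos_add_sin_mul_I hs]
  constructor <;> linarith [Real.pi_pos]

/-- Along a curve that stays in a rotated slit plane, the increment of the imaginary part of a
continuous branch of the logarithm is the increment of the principal argument. -/
theorem Complex.im_sub_im_of_exp_eq_mul {g h : ℝ → ℂ} (hg : Continuous g) (hh : Continuous h)
    (hs : ∀ t, h t ∈ Complex.slitPlane) (u : ℂ) (he : ∀ t, Complex.exp (g t) = u * h t) (s t : ℝ) :
    (g t).im - (g s).im = (h t).arg - (h s).arg := by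
  have hk : Continuous fun t => g t - Complex.log (h t) := hg.sub (hh.clog hs)
  have hexp : ∀ t, Complex.exp (g t - Complex.log (h t)) = u := fun t => by
    have h0 := Complex.slitPlane_ne_zero (hs t)
    rw [Complex.exp_sub, he, Complex.exp_log h0, mul_div_cancel_right₀ _ h0]
  have := Complex.isCoveringMap_exp.eq_of_comp_eq hk
    (continuous_const (y := g s - Complex.log (h s)))
    (by ext t; simp only [Function.comp_apply]; rw [hexp, hexp]) s rfl
  have := congrArg Complex.im (congrFun this t)
  simp only [Complex.sub_im, Complex.log_im] at this
  linarith

theorem Complex.one_sub_mem_slitPlane {z : ℂ} (hz : ‖z‖ ≤ 1) (h1 : z ≠ 1) :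
    1 - z ∈ Complex.slitPlane := by
  rw [Complex.mem_slitPlane_iff]
  have h2 := Complex.re_le_norm z
  by_cases h : z.re = 1
  · right
    intro h3
    apply h1
    apply Complex.ext <;> simp_all
  · left
    simp only [Complex.sub_re, Complex.one_re]
    have : z.re < 1 := lt_of_le_of_ne (h2.trans hz) h
    linarith

/-- Two curves in the closed unit disc whose end points interlace on the unit circle meet. -/
theorem exists_eq_of_interlaced_ends {α β γ δ : ℝ} (h1 : α < β) (h2 : β < γ) (h3 : γ < δ)
    (h4 : δ < α + 2 * Real.pi) (p q : C(unitInterval, ℂ))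
    (hp : ∀ t, ‖p t‖ ≤ 1) (hq : ∀ t, ‖q t‖ ≤ 1)
    (hp0 : p 0 = Complex.exp (α * Complex.I)) (hp1 : p 1 = Complex.exp (γ * Complex.I))
    (hq0 : q 0 = Complex.exp (β * Complex.I)) (hq1 : q 1 = Complex.exp (δ * Complex.I)) :
    ∃ s t, p s = q t := by
  by_contra! hne
  set P : ℝ → ℂ := fun s => p (Set.projIcc 0 1 zero_le_one s) with hP
  set Q : ℝ → ℂ := fun s => q (Set.projIcc 0 1 zero_le_one s) with hQ
  have cP : Continuous P := p.continuous.comp continuous_projIcc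
  have cQ : Continuous Q := q.continuous.comp continuous_projIcc
  have P0 : P 0 = Complex.exp (α * Complex.I) := by simp [hP, ← hp0]
  have P1 : P 1 = Complex.exp (γ * Complex.I) := by simp [hP, ← hp1]
  have Q0 : Q 0 = Complex.exp (β * Complex.I) := by simp [hQ, ← hq0]
  have Q1 : Q 1 = Complex.exp (δ * Complex.I) := by simp [hQ, ← hq1]
  have hPQ : ∀ s t, P s ≠ Q t := fun s t => hne _ _
  have nP : ∀ s, ‖P s‖ ≤ 1 := fun s => hp _
  have nQ : ∀ s, ‖Q s‖ ≤ 1 := fun s => hq _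
  have hsc : IsSimplyConnected (Set.univ : Set (ℝ × ℝ)) := by
    have := (convex_univ (𝕜 := ℝ) (E := ℝ × ℝ)).contractibleSpace Set.univ_nonempty
    exact inferInstanceAs (SimplyConnectedSpace (Set.univ : Set (ℝ × ℝ)))
  -- If the curves never meet, P(s) - Q(t) has a continuous logarithm on the simply connected plane
  -- of parameters.
  obtain ⟨f, hf, hfe⟩ := Complex.exists_continuousOn_eqOn_exp_comp (X := ℝ × ℝ) (U := Set.univ)
    hsc isOpen_univ
    (g := fun x => P x.1 - Q x.2) (by fun_prop) (by
      rintro ⟨x, -, hx⟩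
      exact hPQ _ _ (sub_eq_zero.mp hx))
  rw [continuousOn_univ] at hf
  have hfe' : ∀ s t, Complex.exp (f (s, t)) = P s - Q t := fun s t => hfe (Set.mem_univ (s, t))
  have mulexp : ∀ x y : ℝ, Complex.exp (x * Complex.I) * Complex.exp (((-y : ℝ) : ℂ) * Complex.I)
      = Complex.exp (((x - y : ℝ) : ℂ) * Complex.I) := fun x y => by
    rw [← Complex.exp_add]; congr 1; push_cast; ring
  have hinv : ∀ y : ℝ, Complex.exp (y * Complex.I) * Complex.exp (((-y : ℝ) : ℂ) * Complex.I) = 1 :=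
    fun y => by rw [mulexp]; simp
  have hnorm : ∀ (z : ℂ) (y : ℝ), ‖z * Complex.exp (((-y : ℝ) : ℂ) * Complex.I)‖ = ‖z‖ :=
    fun z y => by rw [norm_mul, Complex.norm_exp_ofReal_mul_I, mul_one]
  have hne1 : ∀ (z : ℂ) (y : ℝ), z ≠ Complex.exp (y * Complex.I) →
      z * Complex.exp (((-y : ℝ) : ℂ) * Complex.I) ≠ 1 := fun z y hz h => by
    apply hz
    rw [← hinv y] at h
    exact mul_right_cancel₀ (Complex.exp_ne_zero _) h
  have hper : ∀ x : ℝ, Complex.exp (((x + 2 * Real.pi : ℝ) : ℂ) * Complex.I) =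
      Complex.exp (x * Complex.I) := fun x => by
    push_cast; rw [add_mul, Complex.exp_add, Complex.exp_two_pi_mul_I, mul_one]
  -- On a side of the parameter square one point rests on the circle. Seen from there the disc lies
  -- in a half plane, so the principal argument measures the increment.
  have sideQ : ∀ (s y : ℝ), P s = Complex.exp (y * Complex.I) →
      (f (s, 1)).im - (f (s, 0)).im =
        Complex.arg (1 - Complex.exp (((δ - y : ℝ) : ℂ) * Complex.I)) -
        Complex.arg (1 - Complex.exp (((β - y : ℝ) : ℂ) * Complex.I)) := by
    intro s y hy
    have := Complex.im_sub_im_of_exp_eq_mul (g := fun t => f (s, t))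
      (h := fun t => 1 - Q t * Complex.exp (((-y : ℝ) : ℂ) * Complex.I)) (by fun_prop)
      (by fun_prop) (fun t => Complex.one_sub_mem_slitPlane (by rw [hnorm]; exact nQ t)
        (hne1 _ _ (by rw [← hy]; exact (hPQ s t).symm))) (Complex.exp (y * Complex.I))
      (fun t => by rw [hfe', hy, mul_sub, mul_one, mul_left_comm, hinv, mul_one]) 0 1
    simpa only [Q0, Q1, mulexp] using this
  have sideP : ∀ (t y : ℝ), Q t = Complex.exp (y * Complex.I) →
      (f (1, t)).im - (f (0, t)).im =
        Complex.arg (1 - Complex.exp (((γ - y : ℝ) : ℂ) * Complex.I)) -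
        Complex.arg (1 - Complex.exp (((α - y : ℝ) : ℂ) * Complex.I)) := by
    intro t y hy
    have := Complex.im_sub_im_of_exp_eq_mul (g := fun s => f (s, t))
      (h := fun s => 1 - P s * Complex.exp (((-y : ℝ) : ℂ) * Complex.I)) (by fun_prop)
      (by fun_prop) (fun s => Complex.one_sub_mem_slitPlane (by rw [hnorm]; exact nP s)
        (hne1 _ _ (by rw [← hy]; exact hPQ s t))) (-Complex.exp (y * Complex.I))
      (fun s => by rw [hfe', hy, mul_sub, mul_one, mul_left_comm, neg_mul, hinv]; ring) 0 1
    simpa only [P0, P1, mulexp] using this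
  have a1 := sideQ 0 α P0
  have a2 := sideQ 1 γ P1
  have a3 := sideP 0 β Q0
  have a4 := sideP 1 δ Q1
  rw [Complex.arg_one_sub_exp_mul_I (by linarith) (by linarith),
    Complex.arg_one_sub_exp_mul_I (by linarith) (by linarith)] at a1
  -- Negative angle differences are shifted by 2π into the range of the half-angle formula.
  rw [Complex.arg_one_sub_exp_mul_I (by linarith) (by linarith), ← hper (β - γ),
    Complex.arg_one_sub_exp_mul_I (by linarith) (by linarith)] at a2
  rw [Complex.arg_one_sub_exp_mul_I (by linarith) (by linarith), ← hper (α - β),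
    Complex.arg_one_sub_exp_mul_I (by linarith) (by linarith)] at a3
  rw [← hper (γ - δ), ← hper (α - δ), Complex.arg_one_sub_exp_mul_I (by linarith) (by linarith),
    Complex.arg_one_sub_exp_mul_I (by linarith) (by linarith)] at a4
  -- The two routes from corner (0, 0) to corner (1, 1) give totals that differ by 2π.
  linarith [Real.pi_pos]

theorem PlaneDrawing.exists_curve {V : Type*} {G : SimpleGraph V} (D : PlaneDrawing G) {u v : V}
    (h : G.Adj u v) : ∃ p : C(unitInterval, ℂ), p 0 = D.pt u ∧ p 1 = D.pt v ∧
      ∀ t, ∃ t', p t = D.arc ⟨s(u, v), h⟩ t' := by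
  have he := D.arc_ends ⟨s(u, v), h⟩
  rw [Sym2.map_mk, Sym2.eq_iff] at he
  rcases he with ⟨h0, h1⟩ | ⟨h0, h1⟩
  · exact ⟨_, h0, h1, fun t => ⟨t, rfl⟩⟩
  · refine ⟨(D.arc ⟨s(u, v), h⟩).comp ⟨unitInterval.symm, unitInterval.continuous_symm⟩, ?_, ?_,
      fun t => ⟨unitInterval.symm t, rfl⟩⟩
    · simpa using h1
    · simpa using h0

theorem PlaneDrawing.end_of_arc_eq_pt {V : Type*} {G : SimpleGraph V} (D : PlaneDrawing G)
    {u v w : V} (h : G.Adj u v) {t : unitInterval} (ht : D.arc ⟨s(u, v), h⟩ t = D.pt w) :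
    w = u ∨ w = v := by
  have he := D.arc_ends ⟨s(u, v), h⟩
  rw [Sym2.map_mk, Sym2.eq_iff] at he
  rcases D.arc_avoids _ _ _ ht with rfl | rfl
  · rcases he with ⟨h0, h1⟩ | ⟨h0, h1⟩
    · exact Or.inl (D.pt_injective (ht.symm.trans h0))
    · exact Or.inr (D.pt_injective (ht.symm.trans h0))
  · rcases he with ⟨h0, h1⟩ | ⟨h0, h1⟩
    · exact Or.inr (D.pt_injective (ht.symm.trans h1))
    · exact Or.inl (D.pt_injective (ht.symm.trans h1))

/-- The vertices of an outerplanar graph have an order in which no two edges interlace. -/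
theorem IsOuterplanar.exists_noncrossing {n : ℕ} {H : SimpleGraph (Fin n)} (hH : IsOuterplanar H) :
    ∃ e : Equiv.Perm (Fin n), ∀ i j k l, i < j → j < k → k < l →
      H.Adj (e i) (e k) → ¬ H.Adj (e j) (e l) := by
  obtain ⟨D, hc, hb⟩ := hH
  set θ : Fin n → ℝ := fun v => Complex.arg (D.pt v)
  have hpt : ∀ v, D.pt v = Complex.exp (θ v * Complex.I) := fun v => by
    have h1 : ‖D.pt v‖ = 1 := by simpa using hc v
    have := Complex.norm_mul_exp_arg_mul_I (D.pt v)
    rw [h1, Complex.ofReal_one, one_mul] at this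
    exact this.symm
  have hinj : Function.Injective θ := fun u v h => D.pt_injective (by rw [hpt, hpt, h])
  have hmono : StrictMono (θ ∘ Tuple.sort θ) :=
    (Tuple.monotone_sort θ).strictMono_of_injective (hinj.comp (Tuple.sort θ).injective)
  refine ⟨Tuple.sort θ, fun i j k l hij hjk hkl h1 h2 => ?_⟩
  obtain ⟨p, hp0, hp1, hp⟩ := D.exists_curve h1
  obtain ⟨q, hq0, hq1, hq⟩ := D.exists_curve h2
  have hnorm : ∀ e t, ‖D.arc e t‖ ≤ 1 := fun e t => by simpa using hb e t
  obtain ⟨s, t, hst⟩ := exists_eq_of_interlaced_ends (hmono hij) (hmono hjk) (hmono hkl)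
    (by
      have := Complex.arg_le_pi (D.pt (Tuple.sort θ l))
      have := Complex.neg_pi_lt_arg (D.pt (Tuple.sort θ i))
      simp only [Function.comp_apply, θ]
      linarith) p q
    (fun t => by obtain ⟨t', h⟩ := hp t; rw [h]; exact hnorm _ _)
    (fun t => by obtain ⟨t', h⟩ := hq t; rw [h]; exact hnorm _ _)
    (by rw [hp0, hpt]; rfl) (by rw [hp1, hpt]; rfl) (by rw [hq0, hpt]; rfl) (by rw [hq1, hpt]; rfl)
  obtain ⟨s', hs'⟩ := hp s
  obtain ⟨t', ht'⟩ := hq t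
  have inj : ∀ {x y}, Tuple.sort θ x = Tuple.sort θ y → x = y := fun h =>
    (Tuple.sort θ).injective h
  have hne : (⟨s(Tuple.sort θ i, Tuple.sort θ k), h1⟩ : H.edgeSet) ≠
      ⟨s(Tuple.sort θ j, Tuple.sort θ l), h2⟩ := fun h => by
    rcases Sym2.eq_iff.mp (congrArg Subtype.val h) with ⟨h, -⟩ | ⟨h, -⟩
    · exact hij.ne (inj h)
    · exact (hij.trans (hjk.trans hkl)).ne (inj h)
  have heq := hs'.symm.trans (hst.trans ht')
  obtain ⟨w, hw⟩ := D.arcs_disjoint _ _ _ _ hne heq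
  -- The arcs can meet only in a common end, but the four ends are distinct.
  rcases D.end_of_arc_eq_pt h1 hw with rfl | rfl <;>
    rcases D.end_of_arc_eq_pt h2 (heq.symm.trans hw) with h | h
  · exact hij.ne (inj h)
  · exact (hij.trans (hjk.trans hkl)).ne (inj h)
  · exact hjk.ne' (inj h)
  · exact hkl.ne (inj h)

/-! ### Triangulated polygons as binary trees. -/

/-- Binary trees: the duals of triangulated polygons with a root edge. -/
inductive BinTree : Type
  | nil : BinTree
  | node (l r : BinTree) : BinTree

namespace BinTree

variable {α : Type*}

def size : BinTree → ℕ
  | nil => 0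
  | node l r => l.size + r.size + 1

def mirror : BinTree → BinTree
  | nil => nil
  | node l r => node r.mirror l.mirror

/-- The larger of the two subtrees at the root is the right one. -/
def RightHeavy : BinTree → Prop
  | nil => True
  | node l r => l.size ≤ r.size

/-- `t.Realize E x y L`: the triangulated polygon with dual `t` and root edge `x y`, whose other
vertices are listed in `L` along the boundary from `x` to `y`, has its edges (except the root edge)
in the relation `E`. -/
def Realize (E : α → α → Prop) : BinTree → α → α → List α → Prop
  | nil, _, _, L => L = []
  | node l r, x, y, L => ∃ w L₁ L₂, L = L₁ ++ w :: L₂ ∧ E x w ∧ E w y ∧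
      l.Realize E x w L₁ ∧ r.Realize E w y L₂

@[simp] theorem size_mirror (t : BinTree) : t.mirror.size = t.size := by
  induction t with
  | nil => rfl
  | node l r hl hr => simp only [mirror, size, hl, hr]; omega

@[simp] theorem mirror_mirror (t : BinTree) : t.mirror.mirror = t := by
  induction t with
  | nil => rfl
  | node l r hl hr => simp only [mirror, hl, hr]

/-- This is why right-heavy trees suffice: any other tree is reflected and realized over the
reversed root edge. -/
theorem rightHeavy_mirror {t : BinTree} (h : ¬ t.RightHeavy) : t.mirror.RightHeavy := by
  cases t with
  | nil => exact trivial
  | node l r => simp only [RightHeavy, mirror, size_mirror] at h ⊢; omega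

theorem Realize.length {E : α → α → Prop} {t : BinTree} {x y : α} {L : List α}
    (h : t.Realize E x y L) : L.length = t.size := by
  induction t generalizing x y L with
  | nil => rw [show L = [] from h]; rfl
  | node l r hl hr =>
    obtain ⟨w, L₁, L₂, rfl, -, -, h1, h2⟩ := h
    simp only [List.length_append, List.length_cons, size, hl h1, hr h2]
    omega

theorem Realize.mirror {E : α → α → Prop} (hE : ∀ x y, E x y → E y x) {t : BinTree} {x y : α}
    {L : List α} (h : t.Realize E x y L) : t.mirror.Realize E y x L.reverse := by
  induction t generalizing x y L with
  | nil => rw [show L = [] from h]; rfl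
  | node l r hl hr =>
    obtain ⟨w, L₁, L₂, rfl, h3, h4, h1, h2⟩ := h
    exact ⟨w, L₂.reverse, L₁.reverse, by simp, hE _ _ h4, hE _ _ h3, hr h2, hl h1⟩

/-- A relation without interlacing pairs on an interval of integers is contained in a
triangulated polygon. -/
theorem exists_of_noncrossing (R : ℕ → ℕ → Prop)
    (hR : ∀ a b c d, a < b → b < c → c < d → R a c → ¬ R b d) (n i j : ℕ) (hj : j = i + 1 + n) :
    ∃ t : BinTree, t.size = n ∧ ∀ (E : α → α → Prop) (x y : α) (L : List α), E x y →
      t.Realize E x y L → ∀ a b u v, i ≤ a → a < b → b ≤ j → R a b →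
      (x :: (L ++ [y]))[a - i]? = some u → (x :: (L ++ [y]))[b - i]? = some v → E u v := by
  classical
  induction n using Nat.strong_induction_on generalizing i j with
  | _ n ih =>
  rcases Nat.eq_zero_or_pos n with rfl | hn
  · refine ⟨nil, rfl, fun E x y L hE hL a b u v ha hab hb _ hu hv => ?_⟩
    rw [show L = [] from hL] at hu hv
    obtain rfl : a = i := by omega
    obtain rfl : b = a + 1 := by omega
    simp at hu hv
    rwa [← hu, ← hv]
  -- The apex over the root edge is the last inner partner of i, or i + 1 if there is none; only the
  -- pair (i, j) can then straddle it.
  obtain ⟨w, hiw, hwj, hw⟩ : ∃ w, i < w ∧ w < j ∧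
      ∀ a b, i ≤ a → a < w → w < b → b ≤ j → R a b → a = i ∧ b = j := by
    by_cases hex : ∃ c, i < c ∧ c < j ∧ R i c
    · obtain ⟨c, hc⟩ := hex
      have hspec := Nat.findGreatest_spec (P := fun c => i < c ∧ c < j ∧ R i c) hc.2.1.le hc
      have hmax := fun k => Nat.findGreatest_is_greatest (P := fun c => i < c ∧ c < j ∧ R i c)
        (n := j) (k := k)
      set w := Nat.findGreatest (fun c => i < c ∧ c < j ∧ R i c) j
      refine ⟨w, hspec.1, hspec.2.1, fun a b ha haw hwb hb hab => ?_⟩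
      rcases ha.eq_or_lt with rfl | ha
      · refine ⟨rfl, ?_⟩
        by_contra hbj
        exact hmax b hwb hb ⟨by omega, by omega, hab⟩
      · exact absurd hab (hR i a w b ha haw hwb hspec.2.2)
    · refine ⟨i + 1, by omega, by omega, fun a b ha haw hwb hb hab => ?_⟩
      obtain rfl : a = i := by omega
      refine ⟨rfl, ?_⟩
      by_contra hbj
      exact hex ⟨b, by omega, by omega, hab⟩
  obtain ⟨l, hl, hl'⟩ := ih (w - i - 1) (by omega) i w (by omega)
  obtain ⟨r, hr, hr'⟩ := ih (j - w - 1) (by omega) w j (by omega)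
  refine ⟨node l r, by simp only [size]; omega, ?_⟩
  intro E x y L hE hL a b u v ha hab hb hRab hu hv
  obtain ⟨z, L₁, L₂, rfl, hxz, hzy, h1, h2⟩ := hL
  have hlen := h1.length
  have hlen2 := h2.length
  have low : ∀ k, k ≤ w → (x :: (L₁ ++ z :: L₂ ++ [y]))[k - i]? = (x :: (L₁ ++ [z]))[k - i]? := by
    intro k hk
    rw [show x :: (L₁ ++ z :: L₂ ++ [y]) = (x :: (L₁ ++ [z])) ++ (L₂ ++ [y]) by simp]
    exact List.getElem?_append_left (by simp; omega)
  have high : ∀ k, w ≤ k → (x :: (L₁ ++ z :: L₂ ++ [y]))[k - i]? = (z :: (L₂ ++ [y]))[k - w]? := by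
    intro k hk
    rw [show x :: (L₁ ++ z :: L₂ ++ [y]) = (x :: L₁) ++ (z :: (L₂ ++ [y])) by simp,
      List.getElem?_append_right (by simp; omega)]
    congr 1
    simp only [List.length_cons]
    omega
  by_cases hbw : b ≤ w
  · rw [low _ (by omega)] at hu hv
    exact hl' E x z L₁ hxz h1 a b u v ha hab hbw hRab hu hv
  by_cases haw : w ≤ a
  · rw [high _ (by omega)] at hu hv
    exact hr' E z y L₂ hzy h2 a b u v haw hab hb hRab hu hv
  obtain ⟨rfl, rfl⟩ := hw a b ha (by omega) (by omega) hb hRab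
  rw [low _ (by omega)] at hu
  rw [high _ (by omega), show b - w = (L₂.length + 1) by omega] at hv
  simp at hu hv
  rwa [← hu, ← hv]

end BinTree

/-! ### Barycentric geometry of a triangle cut at its centroid. -/

/-- Twice the signed area of a triangle. -/
def area (A B C : ℂ) : ℝ :=
  (B.re - A.re) * (C.im - A.im) - (B.im - A.im) * (C.re - A.re)

theorem area_rotate (A B C : ℂ) : area B C A = area A B C := by
  simp only [area]; ring

theorem area_swap (A B C : ℂ) : area B A C = -area A B C := by
  simp only [area]; ring

noncomputable def centroid (A B C : ℂ) : ℂ := (A + B + C) / 3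

theorem area_centroid_left (A B C : ℂ) : area (centroid A B C) B C = area A B C / 3 := by
  simp [area, centroid]; ring

theorem area_centroid_mid (A B C : ℂ) : area A (centroid A B C) C = area A B C / 3 := by
  simp [area, centroid]; ring

theorem area_centroid_right (A B C : ℂ) : area A B (centroid A B C) = area A B C / 3 := by
  simp [area, centroid]; ring

/-- The open triangle with the given corners. -/
def openTriangle (A B C : ℂ) : Set ℂ :=
  {X | ∃ a b c : ℝ, 0 < a ∧ 0 < b ∧ 0 < c ∧ a + b + c = 1 ∧ X = a * A + b * B + c * C}

theorem openTriangle_rotate (A B C : ℂ) : openTriangle B C A = openTriangle A B C := by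
  ext X
  constructor
  · rintro ⟨a, b, c, ha, hb, hc, h, rfl⟩
    exact ⟨c, a, b, hc, ha, hb, by linarith, by ring⟩
  · rintro ⟨a, b, c, ha, hb, hc, h, rfl⟩
    exact ⟨b, c, a, hb, hc, ha, by linarith, by ring⟩

theorem openTriangle_swap (A B C : ℂ) : openTriangle B A C = openTriangle A B C := by
  ext X
  constructor
  · rintro ⟨a, b, c, ha, hb, hc, h, rfl⟩
    exact ⟨b, a, c, hb, ha, hc, by linarith, by ring⟩
  · rintro ⟨a, b, c, ha, hb, hc, h, rfl⟩
    exact ⟨b, a, c, hb, ha, hc, by linarith, by ring⟩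

/-- Cramer's rule, with the area as determinant. -/
theorem barycentric_unique {A B C : ℂ} (h : area A B C ≠ 0) {a b c a' b' c' : ℝ}
    (hs : a + b + c = 1) (hs' : a' + b' + c' = 1)
    (he : (a : ℂ) * A + b * B + c * C = a' * A + b' * B + c' * C) :
    a = a' ∧ b = b' ∧ c = c' := by
  have h1 := congrArg Complex.re he
  have h2 := congrArg Complex.im he
  simp only [Complex.add_re, Complex.add_im, Complex.re_ofReal_mul, Complex.im_ofReal_mul] at h1 h2
  obtain rfl : a = 1 - b - c := by linarith
  obtain rfl : a' = 1 - b' - c' := by linarith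
  have hb : b - b' = 0 := by
    refine (mul_eq_zero.mp (?_ : (b - b') * area A B C = 0)).resolve_right h
    simp only [area]
    linear_combination (C.im - A.im) * h1 - (C.re - A.re) * h2
  have hc : c - c' = 0 := by
    refine (mul_eq_zero.mp (?_ : (c - c') * area A B C = 0)).resolve_right h
    simp only [area]
    linear_combination (B.re - A.re) * h2 - (B.im - A.im) * h1
  refine ⟨?_, ?_, ?_⟩ <;> linarith

theorem left_notMem_openTriangle {A B C : ℂ} (h : area A B C ≠ 0) : A ∉ openTriangle A B C := by
  rintro ⟨a, b, c, ha, hb, hc, hs, he⟩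
  have := barycentric_unique h (a := 1) (b := 0) (c := 0) (by norm_num) hs (by simpa using he)
  linarith [this.2.1]

theorem mid_notMem_openTriangle {A B C : ℂ} (h : area A B C ≠ 0) : B ∉ openTriangle A B C := by
  rw [← openTriangle_rotate]
  exact left_notMem_openTriangle (by rwa [area_rotate])

theorem right_notMem_openTriangle {A B C : ℂ} (h : area A B C ≠ 0) : C ∉ openTriangle A B C := by
  rw [← openTriangle_rotate]
  exact mid_notMem_openTriangle (by rwa [area_rotate])

/-- The pieces into which the open triangle is divided by the three segments from its centroid to
the corners. -/
def trianglePiece (A B C : ℂ) : Fin 7 → Set ℂ :=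
  ![openSegment ℝ (centroid A B C) (centroid A B C), openSegment ℝ (centroid A B C) A,
    openSegment ℝ (centroid A B C) B, openSegment ℝ (centroid A B C) C,
    openTriangle (centroid A B C) B C, openTriangle A (centroid A B C) C,
    openTriangle A B (centroid A B C)]

/-- The order relations of the barycentric coordinates in the pieces of the open triangle. -/
def PieceOrder (a b c : ℝ) : Fin 7 → Prop :=
  ![a = b ∧ b = c, b < a ∧ b = c, a < b ∧ a = c, a < c ∧ a = b, a < b ∧ a < c, b < a ∧ b < c,
    c < a ∧ c < b]

theorem PieceOrder.unique {a b c : ℝ} {i j : Fin 7} (hi : PieceOrder a b c i)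
    (hj : PieceOrder a b c j) : i = j := by
  fin_cases i <;> fin_cases j <;> first | rfl | (simp [PieceOrder] at hi hj; exfalso; linarith)

theorem exists_barycentric_of_mem_trianglePiece {A B C X : ℂ} {i : Fin 7}
    (h : X ∈ trianglePiece A B C i) : ∃ a b c : ℝ, 0 < a ∧ 0 < b ∧ 0 < c ∧ a + b + c = 1 ∧
      X = a * A + b * B + c * C ∧ PieceOrder a b c i := by
  have h3 : (3 : ℂ) ≠ 0 := by norm_num
  fin_cases i <;> simp [trianglePiece] at h <;> simp only [PieceOrder]
  · refine ⟨1 / 3, 1 / 3, 1 / 3, by norm_num, by norm_num, by norm_num, by norm_num, ?_, rfl, rfl⟩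
    rw [h, centroid]; push_cast; ring
  · obtain ⟨s, t, hs, ht, hst, rfl⟩ := h
    refine ⟨s / 3 + t, s / 3, s / 3, by positivity, by positivity, by positivity, by linarith, ?_,
      show s / 3 < s / 3 + t by linarith, rfl⟩
    simp only [centroid, Complex.real_smul]; push_cast; ring
  · obtain ⟨s, t, hs, ht, hst, rfl⟩ := h
    refine ⟨s / 3, s / 3 + t, s / 3, by positivity, by positivity, by positivity, by linarith, ?_,
      show s / 3 < s / 3 + t by linarith, rfl⟩
    simp only [centroid, Complex.real_smul]; push_cast; ring
  · obtain ⟨s, t, hs, ht, hst, rfl⟩ := h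
    refine ⟨s / 3, s / 3, s / 3 + t, by positivity, by positivity, by positivity, by linarith, ?_,
      show s / 3 < s / 3 + t by linarith, rfl⟩
    simp only [centroid, Complex.real_smul]; push_cast; ring
  · obtain ⟨a, b, c, ha, hb, hc, hs, rfl⟩ := h
    refine ⟨a / 3, b + a / 3, c + a / 3, by positivity, by positivity, by positivity, by linarith,
      ?_, show a / 3 < b + a / 3 by linarith, show a / 3 < c + a / 3 by linarith⟩
    simp only [centroid]; push_cast; ring
  · obtain ⟨a, b, c, ha, hb, hc, hs, rfl⟩ := h
    refine ⟨a + b / 3, b / 3, c + b / 3, by positivity, by positivity, by positivity, by linarith,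
      ?_, show b / 3 < a + b / 3 by linarith, show b / 3 < c + b / 3 by linarith⟩
    simp only [centroid]; push_cast; ring
  · obtain ⟨a, b, c, ha, hb, hc, hs, rfl⟩ := h
    refine ⟨a + c / 3, b + c / 3, c / 3, by positivity, by positivity, by positivity, by linarith,
      ?_, show c / 3 < a + c / 3 by linarith, show c / 3 < b + c / 3 by linarith⟩
    simp only [centroid]; push_cast; ring

theorem trianglePiece_subset (A B C : ℂ) (i : Fin 7) :
    trianglePiece A B C i ⊆ openTriangle A B C := fun _ hX => by
  obtain ⟨a, b, c, ha, hb, hc, hs, h, -⟩ := exists_barycentric_of_mem_trianglePiece hX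
  exact ⟨a, b, c, ha, hb, hc, hs, h⟩

/-- A point determines its barycentric coordinates, and their order relations determine the piece.
-/
theorem disjoint_trianglePiece {A B C : ℂ} (h : area A B C ≠ 0) {i j : Fin 7} (hij : i ≠ j) :
    Disjoint (trianglePiece A B C i) (trianglePiece A B C j) := by
  rw [Set.disjoint_left]
  intro X hi hj
  obtain ⟨a, b, c, -, -, -, hs, rfl, oi⟩ := exists_barycentric_of_mem_trianglePiece hi
  obtain ⟨a', b', c', -, -, -, hs', he, oj⟩ := exists_barycentric_of_mem_trianglePiece hj
  obtain ⟨rfl, rfl, rfl⟩ := barycentric_unique h hs hs' he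
  exact hij (oi.unique oj)

theorem centroid_mem_trianglePiece (A B C : ℂ) : centroid A B C ∈ trianglePiece A B C 0 := by
  simp [trianglePiece]

/-! ### Stacked triangles. -/

/-- Recipes for repeatedly inserting a vertex into a triangular face and joining it to the three
corners; `rotate` and `swap` change the order of the corners. -/
inductive Stacking : Type
  | empty : Stacking
  | insert (t₁ t₂ t₃ : Stacking) : Stacking
  | rotate (t : Stacking) : Stacking
  | swap (t : Stacking) : Stacking

namespace Stacking

/-- The vertices inserted into the triangle. -/
noncomputable def pts : Stacking → ℂ → ℂ → ℂ → Finset ℂ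
  | empty, _, _, _ => ∅
  | insert t₁ t₂ t₃, A, B, C => {centroid A B C} ∪ (t₁.pts (centroid A B C) B C ∪
      (t₂.pts A (centroid A B C) C ∪ t₃.pts A B (centroid A B C)))
  | rotate t, A, B, C => t.pts B C A
  | swap t, A, B, C => t.pts B A C

/-- The inserted edges, as pairs of end points, and the inserted vertices, as pairs with equal
entries. -/
noncomputable def cells : Stacking → ℂ → ℂ → ℂ → Set (ℂ × ℂ)
  | empty, _, _, _ => ∅
  | insert t₁ t₂ t₃, A, B, C => ⋃ i : Fin 7,
      (![{(centroid A B C, centroid A B C)}, {(centroid A B C, A)}, {(centroid A B C, B)},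
        {(centroid A B C, C)}, t₁.cells (centroid A B C) B C, t₂.cells A (centroid A B C) C,
        t₃.cells A B (centroid A B C)] : Fin 7 → Set (ℂ × ℂ)) i
  | rotate t, A, B, C => t.cells B C A
  | swap t, A, B, C => t.cells B A C

/-- The number of inserted vertices. -/
def count : Stacking → ℕ
  | empty => 0
  | insert t₁ t₂ t₃ => 1 + (t₁.count + (t₂.count + t₃.count))
  | rotate t => t.count
  | swap t => t.count

theorem openSegment_subset (t : Stacking) (A B C : ℂ) :
    ∀ c ∈ t.cells A B C, openSegment ℝ c.1 c.2 ⊆ openTriangle A B C := by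
  induction t generalizing A B C with
  | empty => simp [cells]
  | rotate t ih => rw [← openTriangle_rotate]; exact ih B C A
  | swap t ih => rw [← openTriangle_swap]; exact ih B A C
  | insert t₁ t₂ t₃ h1 h2 h3 =>
    intro c hc
    obtain ⟨i, hi⟩ := Set.mem_iUnion.mp hc
    refine subset_trans ?_ (trianglePiece_subset A B C i)
    fin_cases i
    · rw [show c = _ from hi]; exact subset_rfl
    · rw [show c = _ from hi]; exact subset_rfl
    · rw [show c = _ from hi]; exact subset_rfl
    · rw [show c = _ from hi]; exact subset_rfl
    · exact h1 _ _ _ _ hi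
    · exact h2 _ _ _ _ hi
    · exact h3 _ _ _ _ hi

/-- Cells of different pieces are separated by the pieces, cells of the same small triangle by
induction. Since a diagonal cell is a one-point segment, this also keeps inserted vertices off the
edges. -/
theorem disjoint_openSegment (t : Stacking) {A B C : ℂ} (h : area A B C ≠ 0) :
    ∀ c ∈ t.cells A B C, ∀ c' ∈ t.cells A B C, c ≠ c' →
      Disjoint (openSegment ℝ c.1 c.2) (openSegment ℝ c'.1 c'.2) := by
  induction t generalizing A B C with
  | empty => simp [cells]
  | rotate t ih => exact ih (by rwa [area_rotate])
  | swap t ih => exact ih (by rwa [area_swap, neg_ne_zero])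
  | insert t₁ t₂ t₃ h1 h2 h3 =>
    intro c hc c' hc' hne
    obtain ⟨i, hi⟩ := Set.mem_iUnion.mp hc
    obtain ⟨j, hj⟩ := Set.mem_iUnion.mp hc'
    have key : ∀ (i : Fin 7) (c : ℂ × ℂ), c ∈ (![{(centroid A B C, centroid A B C)},
        {(centroid A B C, A)}, {(centroid A B C, B)},
        {(centroid A B C, C)}, t₁.cells (centroid A B C) B C, t₂.cells A (centroid A B C) C,
        t₃.cells A B (centroid A B C)] : Fin 7 → Set (ℂ × ℂ)) i →
        openSegment ℝ c.1 c.2 ⊆ trianglePiece A B C i := by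
      intro i c hi
      fin_cases i
      · rw [show c = _ from hi]; exact subset_rfl
      · rw [show c = _ from hi]; exact subset_rfl
      · rw [show c = _ from hi]; exact subset_rfl
      · rw [show c = _ from hi]; exact subset_rfl
      · exact openSegment_subset _ _ _ _ _ hi
      · exact openSegment_subset _ _ _ _ _ hi
      · exact openSegment_subset _ _ _ _ _ hi
    rcases eq_or_ne i j with rfl | hij
    · fin_cases i
      · exact absurd (Eq.trans hi (Eq.symm hj)) hne
      · exact absurd (Eq.trans hi (Eq.symm hj)) hne
      · exact absurd (Eq.trans hi (Eq.symm hj)) hne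
      · exact absurd (Eq.trans hi (Eq.symm hj)) hne
      · exact h1 (by rw [area_centroid_left]; positivity) c hi c' hj hne
      · exact h2 (by rw [area_centroid_mid]; positivity) c hi c' hj hne
      · exact h3 (by rw [area_centroid_right]; positivity) c hi c' hj hne
    · exact (disjoint_trianglePiece h hij).mono (key i c hi) (key j c' hj)

theorem diag_mem_cells (t : Stacking) {A B C x : ℂ} (hx : x ∈ t.pts A B C) :
    (x, x) ∈ t.cells A B C := by
  induction t generalizing A B C with
  | empty => simp [pts] at hx
  | rotate t ih => exact ih hx
  | swap t ih => exact ih hx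
  | insert t₁ t₂ t₃ h1 h2 h3 =>
    simp only [pts, Finset.mem_union, Finset.mem_singleton] at hx
    rw [cells, Set.mem_iUnion]
    rcases hx with rfl | hx | hx | hx
    · exact ⟨0, rfl⟩
    · exact ⟨4, h1 hx⟩
    · exact ⟨5, h2 hx⟩
    · exact ⟨6, h3 hx⟩

theorem pts_subset (t : Stacking) (A B C : ℂ) : ↑(t.pts A B C) ⊆ openTriangle A B C :=
  fun x hx => t.openSegment_subset A B C _ (t.diag_mem_cells hx) (by simp)

theorem disjoint_pts {A B C : ℂ} (h : area A B C ≠ 0) (t₁ t₂ t₃ : Stacking) :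
    centroid A B C ∉ t₁.pts (centroid A B C) B C ∧ centroid A B C ∉ t₂.pts A (centroid A B C) C ∧
    centroid A B C ∉ t₃.pts A B (centroid A B C) ∧
    Disjoint (t₁.pts (centroid A B C) B C) (t₂.pts A (centroid A B C) C) ∧
    Disjoint (t₁.pts (centroid A B C) B C) (t₃.pts A B (centroid A B C)) ∧
    Disjoint (t₂.pts A (centroid A B C) C) (t₃.pts A B (centroid A B C)) := by
  have h1 : area (centroid A B C) B C ≠ 0 := by rw [area_centroid_left]; positivity
  have h2 : area A (centroid A B C) C ≠ 0 := by rw [area_centroid_mid]; positivity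
  have h3 : area A B (centroid A B C) ≠ 0 := by rw [area_centroid_right]; positivity
  simp only [← Finset.disjoint_coe]
  exact ⟨fun hm => left_notMem_openTriangle h1 (pts_subset _ _ _ _ hm),
    fun hm => mid_notMem_openTriangle h2 (pts_subset _ _ _ _ hm),
    fun hm => right_notMem_openTriangle h3 (pts_subset _ _ _ _ hm),
    (disjoint_trianglePiece h (by decide : (4 : Fin 7) ≠ 5)).mono
      (pts_subset _ _ _ _) (pts_subset _ _ _ _),
    (disjoint_trianglePiece h (by decide : (4 : Fin 7) ≠ 6)).mono
      (pts_subset _ _ _ _) (pts_subset _ _ _ _),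
    (disjoint_trianglePiece h (by decide : (5 : Fin 7) ≠ 6)).mono
      (pts_subset _ _ _ _) (pts_subset _ _ _ _)⟩

theorem card_pts (t : Stacking) {A B C : ℂ} (h : area A B C ≠ 0) :
    (t.pts A B C).card = t.count := by
  induction t generalizing A B C with
  | empty => rfl
  | rotate t ih => exact ih (by rwa [area_rotate])
  | swap t ih => exact ih (by rwa [area_swap, neg_ne_zero])
  | insert t₁ t₂ t₃ h1 h2 h3 =>
    obtain ⟨d1, d2, d3, d4, d5, d6⟩ := disjoint_pts h t₁ t₂ t₃
    simp only [pts, count]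
    rw [Finset.card_union_of_disjoint, Finset.card_union_of_disjoint,
      Finset.card_union_of_disjoint d6, h1, h2, h3, Finset.card_singleton]
    · rw [area_centroid_right]; positivity
    · rw [area_centroid_mid]; positivity
    · rw [area_centroid_left]; positivity
    · exact Finset.disjoint_union_right.mpr ⟨d4, d5⟩
    · simp [d1, d2, d3]

end Stacking

/-! ### Planarity of straight-line drawings. -/

/-- A graph is planar if its edges can be drawn as straight segments whose interiors are pairwise
disjoint and contain no vertices. -/
theorem isPlanar_of_segments {V : Type*} {G : SimpleGraph V} (pt : V → ℂ)
    (hpt : Function.Injective pt) (S : Set (ℂ × ℂ))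
    (hG : ∀ u v, G.Adj u v → (pt u, pt v) ∈ S ∨ (pt v, pt u) ∈ S)
    (hS : ∀ c ∈ S, ∀ c' ∈ S, c ≠ c' → Disjoint (openSegment ℝ c.1 c.2) (openSegment ℝ c'.1 c'.2))
    (hv : ∀ v, ∀ c ∈ S, c.1 ≠ c.2 → pt v ∉ openSegment ℝ c.1 c.2) : IsPlanar G := by
  have hex : ∀ e : G.edgeSet, ∃ u v, (e : Sym2 V) = s(u, v) ∧ pt u ≠ pt v ∧ (pt u, pt v) ∈ S := by
    rintro ⟨e, he⟩
    induction e using Sym2.ind with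
    | _ u v =>
    have hne : pt u ≠ pt v := fun h => G.ne_of_adj he (hpt h)
    rcases hG u v he with h | h
    · exact ⟨u, v, rfl, hne, h⟩
    · exact ⟨v, u, Sym2.eq_swap, hne.symm, h⟩
  choose u v he hne hc using hex
  have seg : ∀ e (t : unitInterval), t = 0 ∨ t = 1 ∨
      AffineMap.lineMap (pt (u e)) (pt (v e)) (t : ℝ) ∈ openSegment ℝ (pt (u e)) (pt (v e)) := by
    intro e t
    by_cases h0 : t = 0
    · exact Or.inl h0
    by_cases h1 : t = 1
    · exact Or.inr (Or.inl h1)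
    refine Or.inr (Or.inr ?_)
    rw [openSegment_eq_image_lineMap]
    exact ⟨t, ⟨lt_of_le_of_ne t.2.1 fun h => h0 (Subtype.ext h.symm),
      lt_of_le_of_ne t.2.2 fun h => h1 (Subtype.ext h)⟩, rfl⟩
  refine ⟨{
    pt := pt
    pt_injective := hpt
    arc := fun e => ⟨fun t => AffineMap.lineMap (pt (u e)) (pt (v e)) (t : ℝ), by fun_prop⟩
    arc_injective := fun e s t hst => Subtype.ext (AffineMap.lineMap_injective ℝ (hne e) hst)
    arc_ends := fun e => by simp [he e]
    arc_avoids := fun e t w h => ?_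
    arcs_disjoint := fun e e' t t' hee h => ?_ }⟩
  · rcases seg e t with h0 | h1 | ho
    · exact Or.inl h0
    · exact Or.inr h1
    · simp only [ContinuousMap.coe_mk] at h
      rw [h] at ho
      exact absurd ho (hv w _ (hc e) (hne e))
  · simp only [ContinuousMap.coe_mk] at h ⊢
    rcases seg e t with rfl | rfl | ho
    · exact ⟨u e, by simp⟩
    · exact ⟨v e, by simp⟩
    rcases seg e' t' with rfl | rfl | ho'
    · exact ⟨u e', by rw [h]; simp⟩
    · exact ⟨v e', by rw [h]; simp⟩
    -- A common interior point forces equal pairs of end points, hence equal edges.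
    refine absurd (h ▸ ho') (Set.disjoint_left.mp (hS _ (hc e) _ (hc e') fun heq => hee ?_) ho)
    obtain ⟨h1, h2⟩ := Prod.mk.injEq .. ▸ heq
    exact Subtype.ext (by rw [he e, he e', hpt h1, hpt h2])

namespace Stacking

/-- Two points span an inserted edge or are the same inserted vertex. -/
def Joined (t : Stacking) (A B C x y : ℂ) : Prop :=
  (x, y) ∈ t.cells A B C ∨ (y, x) ∈ t.cells A B C

/-- The vertices of the stacked triangle. -/
noncomputable def vertices (t : Stacking) (A B C : ℂ) : Finset ℂ :=
  {A, B, C} ∪ t.pts A B C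

theorem card_vertices (t : Stacking) {A B C : ℂ} (h : area A B C ≠ 0) :
    (t.vertices A B C).card = 3 + t.count := by
  have hAB : A ≠ B := by rintro rfl; simp [area] at h
  have hAC : A ≠ C := by rintro rfl; simp [area] at h
  have hBC : B ≠ C := by rintro rfl; apply h; simp only [area]; ring
  rw [vertices, Finset.card_union_of_disjoint, card_pts t h,
    Finset.card_eq_three.mpr ⟨A, B, C, hAB, hAC, hBC, rfl⟩]
  rw [Finset.disjoint_right]
  intro x hx
  have := t.pts_subset A B C hx
  simp only [Finset.mem_insert, Finset.mem_singleton]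
  rintro (rfl | rfl | rfl)
  · exact left_notMem_openTriangle h this
  · exact mid_notMem_openTriangle h this
  · exact right_notMem_openTriangle h this

theorem isPlanar_of_joined (t : Stacking) {A B C : ℂ} (h : area A B C ≠ 0) {V : Type*}
    {G : SimpleGraph V} (pt : V → ℂ) (hpt : Function.Injective pt)
    (hmem : ∀ v, pt v ∈ t.vertices A B C)
    (hG : ∀ u v, G.Adj u v → t.Joined A B C (pt u) (pt v)) : IsPlanar G := by
  refine isPlanar_of_segments pt hpt (t.cells A B C) hG (t.disjoint_openSegment h)
    fun v c hc hne ho => ?_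
  have hin := t.openSegment_subset A B C c hc ho
  have hv := hmem v
  simp only [vertices, Finset.mem_union, Finset.mem_insert, Finset.mem_singleton] at hv
  rcases hv with (hv | hv | hv) | hv
  · exact left_notMem_openTriangle h (hv ▸ hin)
  · exact mid_notMem_openTriangle h (hv ▸ hin)
  · exact right_notMem_openTriangle h (hv ▸ hin)
  · refine Set.disjoint_left.mp (t.disjoint_openSegment h _ (t.diag_mem_cells hv) c hc ?_)
      (by simp) ho
    rintro rfl
    exact hne rfl

end Stacking

/-! ### Polygons realized on prescribed vertex sets. -/

namespace BinTree

/-- `t.RealizeIn E x y S`: the triangulated polygon with dual `t` and root edge `x y` can be found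
in the relation `E` with its other vertices being distinct elements of `S`. -/
def RealizeIn {α : Type*} (E : α → α → Prop) (t : BinTree) (x y : α) (S : Set α) : Prop :=
  ∃ L, t.Realize E x y L ∧ L.Nodup ∧ ∀ z ∈ L, z ∈ S

variable {α : Type*} {E : α → α → Prop} {x y w : α} {S S₁ S₂ : Set α} {t l r : BinTree}

theorem realizeIn_nil : nil.RealizeIn E x y S := ⟨[], rfl, List.nodup_nil, by simp⟩

theorem RealizeIn.mono (h : t.RealizeIn E x y S₁) (hS : S₁ ⊆ S) : t.RealizeIn E x y S := by
  obtain ⟨L, h1, h2, h3⟩ := h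
  exact ⟨L, h1, h2, fun z hz => hS (h3 z hz)⟩

theorem RealizeIn.of_mirror (hE : ∀ x y, E x y → E y x) (h : t.mirror.RealizeIn E x y S) :
    t.RealizeIn E y x S := by
  obtain ⟨L, h1, h2, h3⟩ := h
  refine ⟨L.reverse, ?_, List.nodup_reverse.mpr h2, by simpa using h3⟩
  simpa using h1.mirror hE

theorem RealizeIn.node (hl : l.RealizeIn E x w S₁) (hr : r.RealizeIn E w y S₂) (hxw : E x w)
    (hwy : E w y) (h1 : w ∉ S₁) (h2 : w ∉ S₂) (h12 : Disjoint S₁ S₂) :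
    (node l r).RealizeIn E x y (S₁ ∪ {w} ∪ S₂) := by
  obtain ⟨L₁, a1, a2, a3⟩ := hl
  obtain ⟨L₂, b1, b2, b3⟩ := hr
  refine ⟨L₁ ++ w :: L₂, ⟨w, L₁, L₂, rfl, hxw, hwy, a1, b1⟩, ?_, ?_⟩
  · rw [List.nodup_append, List.nodup_cons]
    refine ⟨a2, ⟨fun h => h2 (b3 _ h), b2⟩, fun a ha b hb => ?_⟩
    rcases List.mem_cons.mp hb with rfl | hb
    · exact fun h => h1 (h ▸ a3 a ha)
    · exact fun h => Set.disjoint_left.mp h12 (a3 a ha) (h ▸ b3 b hb)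
  · intro z hz
    rcases List.mem_append.mp hz with h | h
    · exact Or.inl (Or.inl (a3 z h))
    rcases List.mem_cons.mp h with rfl | h
    · exact Or.inl (Or.inr rfl)
    · exact Or.inr (b3 z h)

end BinTree

/-! ### Fans, spines and universal stackings. -/

namespace Stacking

open BinTree

/-- In a triangle with corners `a`, `b`, `p`: a path of `k` vertices, starting next to `a`, whose
vertices are joined to `b` and `p`, with copies of `L` attached to its edges. -/
def fan (L : Stacking) : ℕ → Stacking
  | 0 => L.rotate.rotate
  -- With q the first inserted vertex, the copies of `L` have base edges q→p, p→a, q→a, a→q in this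
  -- order; one over a→p comes from outside the triangle.
  | k + 1 => insert (fan L k) (insert L.rotate L.rotate.rotate L.swap) L.rotate.swap

/-- In a triangle with corners `a`, `b`, `z`: a path of `k` vertices that together with `a`, `b`
forms a zigzag strip, with fans in the triangles of the strip. -/
def spine (L : Stacking) : ℕ → Stacking
  | 0 => empty
  -- For the new vertex p, `swap` gives the remaining strip the base b→p: hence the zigzag.
  | k + 1 => insert (spine L k).swap L (fan L k)

/-- A stacking that contains all right-heavy triangulated polygons with at most `m` vertices
besides the root edge. -/
def rightHeavyUniversal : ℕ → Stacking
  | 0 => empty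
  -- The root uses one vertex, so the smaller of the two subtrees has at most m / 2.
  | m + 1 => spine (rightHeavyUniversal (m / 2)) (m + 1)
  decreasing_by omega

/-- A stacking that contains all triangulated polygons with at most `m` vertices besides the root
edge. -/
def universal (m : ℕ) : Stacking :=
  insert empty (rightHeavyUniversal m).swap (rightHeavyUniversal m).rotate.swap

/-- With `E` arbitrary, a copy of `T` in a face of a larger stacking can use the ambient relation;
the base edge is supplied by the surroundings. -/
def IsRightHeavyUniversal (T : Stacking) (m : ℕ) : Prop :=
  ∀ A B C : ℂ, area A B C ≠ 0 → ∀ E : ℂ → ℂ → Prop, (∀ x y, E x y → E y x) →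
    (∀ c ∈ T.cells A B C, E c.1 c.2) → E A B → ∀ t : BinTree, t.RightHeavy → t.size ≤ m →
    t.RealizeIn E A B (T.pts A B C)

theorem forall_mem_cells_insert {t₁ t₂ t₃ : Stacking} {A B C : ℂ} {E : ℂ → ℂ → Prop}
    (h : ∀ c ∈ (insert t₁ t₂ t₃).cells A B C, E c.1 c.2) :
    E (centroid A B C) A ∧ E (centroid A B C) B ∧ E (centroid A B C) C ∧
    (∀ c ∈ t₁.cells (centroid A B C) B C, E c.1 c.2) ∧
    (∀ c ∈ t₂.cells A (centroid A B C) C, E c.1 c.2) ∧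
    (∀ c ∈ t₃.cells A B (centroid A B C), E c.1 c.2) :=
  ⟨h (_, _) (Set.mem_iUnion.mpr ⟨1, rfl⟩), h (_, _) (Set.mem_iUnion.mpr ⟨2, rfl⟩),
    h (_, _) (Set.mem_iUnion.mpr ⟨3, rfl⟩), fun c hc => h c (Set.mem_iUnion.mpr ⟨4, hc⟩),
    fun c hc => h c (Set.mem_iUnion.mpr ⟨5, hc⟩), fun c hc => h c (Set.mem_iUnion.mpr ⟨6, hc⟩)⟩

theorem coe_pts_insert (t₁ t₂ t₃ : Stacking) (A B C : ℂ) :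
    ((insert t₁ t₂ t₃).pts A B C : Set ℂ) = {centroid A B C} ∪ (↑(t₁.pts (centroid A B C) B C) ∪
      (↑(t₂.pts A (centroid A B C) C) ∪ ↑(t₃.pts A B (centroid A B C)))) := by
  simp [pts]

theorem area_centroid_left_ne {A B C : ℂ} (h : area A B C ≠ 0) :
    area (centroid A B C) B C ≠ 0 := by rw [area_centroid_left]; positivity

theorem area_centroid_mid_ne {A B C : ℂ} (h : area A B C ≠ 0) :
    area A (centroid A B C) C ≠ 0 := by rw [area_centroid_mid]; positivity

theorem area_centroid_right_ne {A B C : ℂ} (h : area A B C ≠ 0) :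
    area A B (centroid A B C) ≠ 0 := by rw [area_centroid_right]; positivity

variable {L : Stacking} {ℓ : ℕ}

/-- The copy over p→a serves the left subtrees over a→p that are not right-heavy. -/
theorem realizeIn_fan_side (hL : L.IsRightHeavyUniversal ℓ) (k : ℕ) {a b p : ℂ}
    (h : area a b p ≠ 0) {E : ℂ → ℂ → Prop} (hE : ∀ x y, E x y → E y x)
    (hc : ∀ c ∈ (fan L k).cells a b p, E c.1 c.2) (hap : E a p) {t : BinTree}
    (ht : t.RightHeavy) (hs : t.size ≤ ℓ) : t.RealizeIn E p a ((fan L k).pts a b p) := by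
  cases k with
  | zero => exact hL p a b (by rwa [← area_rotate]) E hE hc (hE _ _ hap) t ht hs
  | succ k =>
    obtain ⟨-, -, -, -, hc, -⟩ := forall_mem_cells_insert hc
    obtain ⟨-, -, -, -, hc, -⟩ := forall_mem_cells_insert hc
    refine (hL p a (centroid a (centroid a b p) p) ?_ E hE hc (hE _ _ hap) t ht hs).mono ?_
    · rw [← area_rotate]
      exact area_centroid_mid_ne (area_centroid_mid_ne h)
    · rw [fan, coe_pts_insert, coe_pts_insert]
      exact fun z hz => Or.inr (Or.inr (Or.inl (Or.inr (Or.inr (Or.inl hz)))))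

/-- The end of a run around b: p becomes the apex, and the right subtree is reflected and handed to
the remaining strip, here S₂. The bound on k makes the left subtree fit into `L`. -/
theorem realizeIn_fan_last (hL : L.IsRightHeavyUniversal ℓ) (k : ℕ) (hk : k ≤ 2 * ℓ + 1)
    {a b p : ℂ} (h : area a b p ≠ 0) {E : ℂ → ℂ → Prop} (hE : ∀ x y, E x y → E y x)
    (hc : ∀ c ∈ (fan L k).cells a b p, E c.1 c.2) (hap : E a p) (hbp : E b p)
    {S₁ S₂ : Set ℂ}
    (hS₁ : ∀ t : BinTree, t.RightHeavy → t.size ≤ ℓ → t.RealizeIn E a p S₁)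
    (hS₂ : ∀ t : BinTree, t.RightHeavy → t.size ≤ k → t.RealizeIn E b p S₂)
    (d₂ : Disjoint S₂ (openTriangle a b p))
    (d₁₂ : Disjoint S₁ S₂) (hp₁ : p ∉ S₁) (hp₂ : p ∉ S₂) {l r : BinTree} (hlr : l.size ≤ r.size)
    (hs : l.size + r.size ≤ k) (hr : r.mirror.RightHeavy) :
    (node l r).RealizeIn E a b (S₁ ∪ S₂ ∪ {p} ∪ (fan L k).pts a b p) := by
  have hl : l.RealizeIn E a p (S₁ ∪ (fan L k).pts a b p) := by
    by_cases hl : l.RightHeavy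
    · exact (hS₁ l hl (by omega)).mono Set.subset_union_left
    · exact (RealizeIn.of_mirror hE (realizeIn_fan_side hL k h hE hc hap (rightHeavy_mirror hl)
        (by rw [size_mirror]; omega))).mono Set.subset_union_right
  have hr : r.RealizeIn E p b S₂ := RealizeIn.of_mirror hE (hS₂ _ hr (by rw [size_mirror]; omega))
  refine (hl.node hr hap (hE _ _ hbp) ?_ hp₂ ?_).mono ?_
  · rintro (hp | hp)
    · exact hp₁ hp
    · exact right_notMem_openTriangle h (pts_subset _ _ _ _ hp)
  · exact Set.disjoint_union_left.mpr ⟨d₁₂, (d₂.mono_right (pts_subset _ _ _ _)).symm⟩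
  · rintro z (((hz | hz) | hz) | hz)
    · exact Or.inl (Or.inl (Or.inl hz))
    · exact Or.inr hz
    · exact Or.inl (Or.inr hz)
    · exact Or.inl (Or.inl (Or.inr hz))

/-- While the right subtree is right-heavy, the run around b continues with the next path vertex of
the fan as apex; otherwise, or if that subtree is empty, p ends it. -/
theorem realizeIn_fan (hL : L.IsRightHeavyUniversal ℓ) (k : ℕ) (hk : k ≤ 2 * ℓ + 1) {a b p : ℂ}
    (h : area a b p ≠ 0) {E : ℂ → ℂ → Prop} (hE : ∀ x y, E x y → E y x)
    (hc : ∀ c ∈ (fan L k).cells a b p, E c.1 c.2) (hap : E a p) (hbp : E b p)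
    {S₁ S₂ : Set ℂ}
    (hS₁ : ∀ t : BinTree, t.RightHeavy → t.size ≤ ℓ → t.RealizeIn E a p S₁)
    (hS₂ : ∀ t : BinTree, t.RightHeavy → t.size ≤ k → t.RealizeIn E b p S₂)
    (d₁ : Disjoint S₁ (openTriangle a b p)) (d₂ : Disjoint S₂ (openTriangle a b p))
    (d₁₂ : Disjoint S₁ S₂) (hp₁ : p ∉ S₁) (hp₂ : p ∉ S₂) {l r : BinTree} (hlr : l.size ≤ r.size)
    (hs : l.size + r.size ≤ k) :
    (node l r).RealizeIn E a b (S₁ ∪ S₂ ∪ {p} ∪ (fan L k).pts a b p) := by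
  induction k generalizing a b p S₁ S₂ l r with
  | zero =>
    cases r with
    | nil => exact realizeIn_fan_last hL 0 hk h hE hc hap hbp hS₁ hS₂ d₂ d₁₂ hp₁ hp₂ hlr hs trivial
    | node l' r' => simp [size] at hs
  | succ k ih =>
  cases r with
  | nil =>
    exact realizeIn_fan_last hL _ hk h hE hc hap hbp hS₁ hS₂ d₂ d₁₂ hp₁ hp₂ hlr hs trivial
  | node l' r' =>
  by_cases hr : (BinTree.node l' r').RightHeavy
  swap
  · exact realizeIn_fan_last hL _ hk h hE hc hap hbp hS₁ hS₂ d₂ d₁₂ hp₁ hp₂ hlr hs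
      (rightHeavy_mirror hr)
  have hlr' : l'.size ≤ r'.size := hr
  simp only [size] at hlr hs
  obtain ⟨hqa, hqb, hqp, hcF, hcI, hcJ⟩ := forall_mem_cells_insert hc
  obtain ⟨-, hsq, -, hcI1, -, hcI3⟩ := forall_mem_cells_insert hcI
  have ha4 := area_centroid_left_ne h
  have ha5 := area_centroid_mid_ne h
  have ha6 := area_centroid_right_ne h
  have hI1 : openTriangle (centroid a (centroid a b p) p) (centroid a b p) p ⊆
      openTriangle a (centroid a b p) p := trianglePiece_subset a (centroid a b p) p 4
  have hI3 : openTriangle a (centroid a b p) (centroid a (centroid a b p) p) ⊆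
      openTriangle a (centroid a b p) p := trianglePiece_subset a (centroid a b p) p 6
  have h4 : openTriangle (centroid a b p) b p ⊆ openTriangle a b p := trianglePiece_subset a b p 4
  have h5 : openTriangle a (centroid a b p) p ⊆ openTriangle a b p := trianglePiece_subset a b p 5
  have h6 : openTriangle a b (centroid a b p) ⊆ openTriangle a b p := trianglePiece_subset a b p 6
  have d45 : Disjoint (openTriangle (centroid a b p) b p) (openTriangle a (centroid a b p) p) :=
    disjoint_trianglePiece h (by decide : (4 : Fin 7) ≠ 5)
  have d46 : Disjoint (openTriangle (centroid a b p) b p) (openTriangle a b (centroid a b p)) :=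
    disjoint_trianglePiece h (by decide : (4 : Fin 7) ≠ 6)
  have d56 : Disjoint (openTriangle a (centroid a b p) p) (openTriangle a b (centroid a b p)) :=
    disjoint_trianglePiece h (by decide : (5 : Fin 7) ≠ 6)
  have dI : Disjoint (openTriangle (centroid a (centroid a b p) p) (centroid a b p) p)
      (openTriangle a (centroid a b p) (centroid a (centroid a b p) p)) :=
    disjoint_trianglePiece ha5 (by decide : (4 : Fin 7) ≠ 6)
  have hq : centroid a b p ∈ openTriangle a b p :=
    trianglePiece_subset a b p 0 (centroid_mem_trianglePiece a b p)
  have q4 : centroid a b p ∉ openTriangle (centroid a b p) b p := left_notMem_openTriangle ha4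
  have q5 : centroid a b p ∉ openTriangle a (centroid a b p) p := mid_notMem_openTriangle ha5
  have q6 : centroid a b p ∉ openTriangle a b (centroid a b p) := right_notMem_openTriangle ha6
  have p5 : p ∉ openTriangle a (centroid a b p) p := right_notMem_openTriangle ha5
  have pT : p ∉ openTriangle a b p := right_notMem_openTriangle h
  have ptsF := (fan L k).pts_subset (centroid a b p) b p
  have ptsI1 := L.rotate.pts_subset (centroid a (centroid a b p) p) (centroid a b p) p
  have ptsI3 := L.swap.pts_subset a (centroid a b p) (centroid a (centroid a b p) p)
  have ptsJ := L.rotate.swap.pts_subset a b (centroid a b p)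
  have ha1 := area_centroid_left_ne ha5
  have ha3 := area_centroid_right_ne ha5
  set q := centroid a b p
  set s := centroid a q p
  -- Now q plays the part of a: the copy over q→p replaces S₁, while S₂ is kept unused for the end
  -- of the run.
  have right := ih (by omega) ha4 hcF hqp hbp
    (S₁ := L.rotate.pts s q p) (S₂ := S₂)
    (fun t ht hts => hL q p s (by rwa [area_rotate]) E hE hcI1 hqp t ht hts)
    (fun t ht hts => hS₂ t ht (by omega))
    (d45.symm.mono_left (ptsI1.trans hI1)) (d₂.mono_right h4)
    (d₂.symm.mono_left ((ptsI1.trans hI1).trans h5)) (fun hp => p5 (hI1 (ptsI1 hp))) hp₂ hlr'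
    (by omega)
  have left : l.RealizeIn E a q (L.rotate.swap.pts a b q ∪ L.swap.pts a q s) := by
    by_cases hl : l.RightHeavy
    · exact (hL a q b (by rw [← area_rotate, area_swap, area_rotate]; simpa using ha6) E hE hcJ
        (hE _ _ hqa) l hl (by omega)).mono Set.subset_union_left
    · exact (RealizeIn.of_mirror hE (hL q a s (by rw [area_swap]; simpa using ha3) E hE hcI3 hqa _
        (rightHeavy_mirror hl) (by rw [size_mirror]; omega))).mono Set.subset_union_right
  refine (left.node right (hE _ _ hqa) hqb ?_ ?_ ?_).mono ?_
  · rintro (hz | hz)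
    · exact q6 (ptsJ hz)
    · exact q5 (hI3 (ptsI3 hz))
  · rintro (((hz | hz) | hz) | hz)
    · exact q5 (hI1 (ptsI1 hz))
    · exact Set.disjoint_left.mp d₂ hz hq
    · exact pT (hz ▸ hq)
    · exact q4 (ptsF hz)
  · rw [Set.disjoint_left]
    rintro z (hz | hz) (((hw | hw) | hw) | hw)
    · exact Set.disjoint_left.mp d56 (hI1 (ptsI1 hw)) (ptsJ hz)
    · exact Set.disjoint_left.mp d₂ hw (h6 (ptsJ hz))
    · exact pT (hw ▸ h6 (ptsJ hz))
    · exact Set.disjoint_left.mp d46 (ptsF hw) (ptsJ hz)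
    · exact Set.disjoint_left.mp dI (ptsI1 hw) (ptsI3 hz)
    · exact Set.disjoint_left.mp d₂ hw (h5 (hI3 (ptsI3 hz)))
    · exact p5 (hw ▸ hI3 (ptsI3 hz))
    · exact Set.disjoint_left.mp d45 (ptsF hw) (hI3 (ptsI3 hz))
  · rw [fan, coe_pts_insert, coe_pts_insert]
    simp only [Set.subset_def, Set.mem_union]
    tauto

/-- The fan handles the first run; the copy of `L` over a→p and, by induction, the shorter spine
over b→p provide its sets S₁ and S₂. -/
theorem isRightHeavyUniversal_spine (hL : L.IsRightHeavyUniversal ℓ) (k : ℕ)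
    (hk : k ≤ 2 * ℓ + 2) : (spine L k).IsRightHeavyUniversal k := by
  induction k with
  | zero =>
    rintro A B C - E - - - (- | ⟨l, r⟩) - hs
    · exact realizeIn_nil
    · simp [size] at hs
  | succ k ih =>
    rintro a b z h E hE hc hab (- | ⟨l, r⟩) ht hs
    · exact realizeIn_nil
    simp only [size] at hs
    obtain ⟨hpa, hpb, hpz, hcS, hcL, hcF⟩ := forall_mem_cells_insert hc
    have ha4 := area_centroid_left_ne h
    have ha5 := area_centroid_mid_ne h
    have ha6 := area_centroid_right_ne h
    have ptsS := (spine L k).swap.pts_subset (centroid a b z) b z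
    have ptsL := L.pts_subset a (centroid a b z) z
    refine (realizeIn_fan hL k (by omega) ha6 hE hcF (hE _ _ hpa) (hE _ _ hpb)
      (S₁ := L.pts a (centroid a b z) z) (S₂ := (spine L k).swap.pts (centroid a b z) b z)
      (fun t ht hts => hL _ _ _ ha5 E hE hcL (hE _ _ hpa) t ht hts)
      (fun t ht hts => ih (by omega) _ _ _ (by rw [area_swap]; simpa using ha4) E hE hcS
        (hE _ _ hpb) t ht hts)
      ((disjoint_trianglePiece h (by decide : (5 : Fin 7) ≠ 6)).mono_left ptsL)
      ((disjoint_trianglePiece h (by decide : (4 : Fin 7) ≠ 6)).mono_left ptsS)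
      ((disjoint_trianglePiece h (by decide : (5 : Fin 7) ≠ 4)).mono ptsL ptsS)
      (fun hp => mid_notMem_openTriangle ha5 (ptsL hp))
      (fun hp => left_notMem_openTriangle ha4 (ptsS hp)) ht (by omega)).mono ?_
    rw [spine, coe_pts_insert]
    simp only [Set.subset_def, Set.mem_union]
    tauto

theorem isRightHeavyUniversal_rightHeavyUniversal (m : ℕ) :
    (rightHeavyUniversal m).IsRightHeavyUniversal m := by
  induction m using Nat.strong_induction_on with
  | _ m ih =>
  cases m with
  | zero =>
    rw [rightHeavyUniversal]
    exact isRightHeavyUniversal_spine (L := empty) (ℓ := 0)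
      (by
        rintro A B C - E - - - (- | ⟨l, r⟩) - hs
        · exact realizeIn_nil
        · simp [size] at hs) 0 (by omega)
  | succ m =>
    rw [rightHeavyUniversal]
    exact isRightHeavyUniversal_spine (ih (m / 2) (by omega)) _ (by omega)

/-- The root edge of the copies of triangulated polygons joins the first corner to the centroid. -/
theorem realizeIn_universal (m : ℕ) {A B C : ℂ} (h : area A B C ≠ 0) {t : BinTree}
    (ht : t.size ≤ m) : t.RealizeIn ((universal m).Joined A B C) A (centroid A B C)
      ((universal m).pts A B C \ {centroid A B C}) := by
  have hE : ∀ x y, (universal m).Joined A B C x y → (universal m).Joined A B C y x :=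
    fun x y => Or.symm
  have hc : ∀ c ∈ (universal m).cells A B C, (universal m).Joined A B C c.1 c.2 :=
    fun c => Or.inl
  obtain ⟨hPA, -, -, -, hc2, hc3⟩ := forall_mem_cells_insert hc
  obtain ⟨-, n2, n3, -⟩ := disjoint_pts h empty (rightHeavyUniversal m).swap
    (rightHeavyUniversal m).rotate.swap
  have hU := isRightHeavyUniversal_rightHeavyUniversal m
  by_cases hr : t.RightHeavy
  · refine (hU A (centroid A B C) B ?_ _ hE hc3 (hE _ _ hPA) t hr ht).mono ?_
    · rw [← area_rotate, area_swap, area_rotate]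
      simpa using area_centroid_right_ne h
    · refine Set.subset_sdiff_singleton ?_ n3
      rw [universal, coe_pts_insert]
      exact fun z hz => Or.inr (Or.inr (Or.inr hz))
  · refine (RealizeIn.of_mirror hE (hU (centroid A B C) A C ?_ _ hE hc2 hPA _ (rightHeavy_mirror hr)
      (by rwa [size_mirror]))).mono ?_
    · rw [area_swap]
      simpa using area_centroid_mid_ne h
    · refine Set.subset_sdiff_singleton ?_ n2
      rw [universal, coe_pts_insert]
      exact fun z hz => Or.inr (Or.inr (Or.inl hz))

theorem joined_universal (m : ℕ) (A B C : ℂ) :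
    (universal m).Joined A B C A (centroid A B C) :=
  Or.inr (forall_mem_cells_insert (E := fun x y => (x, y) ∈ (universal m).cells A B C)
    fun _ h => h).1

end Stacking

/-! ### Vertex counts and the universal graph. -/

namespace Stacking

theorem count_fan (L : Stacking) (k : ℕ) :
    (fan L k).count = 2 * k + (4 * k + 1) * L.count := by
  induction k with
  | zero => simp [fan, count]
  | succ k ih => simp only [fan, count, ih]; ring

/-- Step k adds (2k + 1)(1 + 2|L|) vertices, and the odd numbers sum to squares. -/
theorem count_spine (L : Stacking) (k : ℕ) :
    (spine L k).count = k ^ 2 * (1 + 2 * L.count) := by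
  induction k with
  | zero => simp [spine, count]
  | succ k ih => simp only [spine, count, ih, count_fan]; ring

theorem count_universal_zero : (universal 0).count = 1 := by
  simp [universal, count, rightHeavyUniversal]

/-- The factor 1 + 2|L| from the spine is itself the count of a universal stacking, which closes the
recursion. -/
theorem count_universal_succ (m : ℕ) :
    (universal (m + 1)).count = 1 + 2 * (m + 1) ^ 2 * (universal (m / 2)).count := by
  simp only [universal, count]
  rw [rightHeavyUniversal, count_spine]
  ring

theorem exists_universal_graph (m : ℕ) :
    ∃ G : SimpleGraph (Fin (3 + (universal m).count)), IsPlanar G ∧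
      ∀ H : SimpleGraph (Fin (m + 2)), IsOuterplanar H → SimpleGraph.IsContained H G := by
  have harea : area 0 1 Complex.I ≠ 0 := by simp [area]
  have hcard := (universal m).card_vertices harea
  set A : ℂ := 0
  set B : ℂ := 1
  set C : ℂ := Complex.I
  let φ : (universal m).vertices A B C ≃ Fin (3 + (universal m).count) :=
    Finset.equivFinOfCardEq hcard
  let pt : Fin (3 + (universal m).count) → ℂ := fun i => (φ.symm i : ℂ)
  have hpt : Function.Injective pt := Subtype.val_injective.comp φ.symm.injective
  have hptφ : ∀ x (hx : x ∈ (universal m).vertices A B C), pt (φ ⟨x, hx⟩) = x := fun x hx => by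
    simp [pt]
  let G : SimpleGraph (Fin (3 + (universal m).count)) :=
    { Adj := fun i j => i ≠ j ∧ (universal m).Joined A B C (pt i) (pt j)
      symm := ⟨fun i j h => ⟨h.1.symm, h.2.symm⟩⟩
      loopless := ⟨fun i h => h.1 rfl⟩ }
  refine ⟨G, (universal m).isPlanar_of_joined harea pt hpt (fun i => (φ.symm i).2)
    (fun u v h => h.2), fun H hH => ?_⟩
  obtain ⟨e, he⟩ := hH.exists_noncrossing
  let R : ℕ → ℕ → Prop := fun a b => ∃ (ha : a < m + 2) (hb : b < m + 2),
    H.Adj (e ⟨a, ha⟩) (e ⟨b, hb⟩)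
  obtain ⟨t, ht, hR⟩ := BinTree.exists_of_noncrossing (α := ℂ) R
    (fun a b c d hab hbc hcd ⟨_, _, h1⟩ ⟨_, _, h2⟩ =>
      he ⟨a, _⟩ ⟨b, _⟩ ⟨c, _⟩ ⟨d, _⟩ hab hbc hcd h1 h2) m 0 (m + 1) (by omega)
  obtain ⟨L, hL, hnd, hmem⟩ := realizeIn_universal m harea ht.le
  set P := centroid A B C
  set K := A :: (L ++ [P]) with hK
  have hlen : K.length = m + 2 := by simp [hK, hL.length, ht]
  have hPmem : P ∈ (universal m).pts A B C := by simp [universal, pts, P]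
  have hLpts : ∀ z ∈ L, z ∈ (universal m).pts A B C := fun z hz => (hmem z hz).1
  have hApts : A ∉ (universal m).pts A B C := fun h =>
    left_notMem_openTriangle harea (pts_subset _ _ _ _ h)
  have hKnd : K.Nodup := by
    rw [hK, List.nodup_cons, List.nodup_append]
    refine ⟨fun h => ?_, hnd, List.nodup_singleton _, fun a ha b hb => ?_⟩
    · rcases List.mem_append.mp h with h | h
      · exact hApts (hLpts _ h)
      · rw [List.mem_singleton] at h
        exact hApts (h ▸ hPmem)
    · rw [List.mem_singleton] at hb
      rintro rfl
      exact (hmem a ha).2 hb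
  have hKmem : ∀ z ∈ K, z ∈ (universal m).vertices A B C := by
    intro z hz
    rw [vertices, Finset.mem_union]
    rcases List.mem_cons.mp hz with rfl | hz
    · simp
    rcases List.mem_append.mp hz with hz | hz
    · exact Or.inr (hLpts z hz)
    · rw [List.mem_singleton] at hz
      exact Or.inr (hz ▸ hPmem)
  have hlt : ∀ v : Fin (m + 2), (v : ℕ) < K.length := fun v => by rw [hlen]; exact v.2
  let f : Fin (m + 2) → Fin (3 + (universal m).count) := fun v =>
    φ ⟨K[(e.symm v : ℕ)]'(hlt _), hKmem _ (List.getElem_mem _)⟩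
  have hf : ∀ v, pt (f v) = K[(e.symm v : ℕ)]'(hlt _) := fun v => hptφ _ _
  have hfinj : Function.Injective f := by
    intro u v huv
    have h1 := congrArg pt huv
    rw [hf, hf, hKnd.getElem_inj_iff] at h1
    exact e.symm.injective (Fin.ext h1)
  have key : ∀ u v, H.Adj u v → e.symm u < e.symm v →
      (universal m).Joined A B C (pt (f u)) (pt (f v)) := by
    intro u v huv hlt'
    refine hR _ A P L (joined_universal m A B C) hL (e.symm u) (e.symm v) _ _ (Nat.zero_le _) hlt'
      (by omega) ⟨(e.symm u).2, (e.symm v).2, by simpa using huv⟩ ?_ ?_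
    · rw [hf]; exact List.getElem?_eq_getElem (hlt _)
    · rw [hf]; exact List.getElem?_eq_getElem (hlt _)
  refine ⟨⟨⟨f, fun {u v} huv => ⟨hfinj.ne huv.ne, ?_⟩⟩, hfinj⟩⟩
  rcases lt_or_gt_of_ne (e.symm.injective.ne huv.ne) with h | h
  · exact key u v huv h
  · exact (key v u huv.symm h).symm

end Stacking

/-! ### Growth of the number of vertices. -/

/-- The function `x ^ (2 log₂ x)`. -/
noncomputable def quasiPoly (x : ℝ) : ℝ := x ^ (2 * Real.logb 2 x)

theorem quasiPoly_one : quasiPoly 1 = 1 := by simp [quasiPoly]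

theorem quasiPoly_two : quasiPoly 2 = 4 := by
  rw [quasiPoly, Real.logb_self_eq_one (by norm_num)]; norm_num

/-- Doubling the argument is compared with one step of the recursion for the counts. -/
theorem quasiPoly_two_mul {x : ℝ} (hx : 0 < x) :
    quasiPoly (2 * x) = 4 * x ^ 4 * quasiPoly x := by
  have h2 : (2 : ℝ) ^ (2 * Real.logb 2 x) = x ^ 2 := by
    rw [mul_comm, Real.rpow_mul (by norm_num), Real.rpow_logb (by norm_num) (by norm_num) hx,
      Real.rpow_two]
  rw [quasiPoly, quasiPoly, Real.logb_mul (by norm_num) hx.ne', Real.logb_self_eq_one (by norm_num),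
    mul_add, Real.rpow_add (by positivity), mul_one, Real.rpow_two,
    Real.mul_rpow (by norm_num) hx.le, h2]
  ring

theorem one_le_quasiPoly {x : ℝ} (hx : 1 ≤ x) : 1 ≤ quasiPoly x :=
  Real.one_le_rpow hx (mul_nonneg (by norm_num) (Real.logb_nonneg (by norm_num) hx))

theorem quasiPoly_mono {x y : ℝ} (hx : 1 ≤ x) (hxy : x ≤ y) : quasiPoly x ≤ quasiPoly y := by
  have hl : Real.logb 2 x ≤ Real.logb 2 y :=
    Real.logb_le_logb_of_le (by norm_num) (by linarith) hxy
  calc x ^ (2 * Real.logb 2 x) ≤ x ^ (2 * Real.logb 2 y) :=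
        Real.rpow_le_rpow_of_exponent_le hx (by linarith)
    _ ≤ y ^ (2 * Real.logb 2 y) :=
        Real.rpow_le_rpow (by linarith) hxy
          (mul_nonneg (by norm_num) (Real.logb_nonneg (by norm_num) (hx.trans hxy)))

/-- Makes room for the three corners: the exponent is at least 2, and (x + 1)² exceeds x² by more
than 3. -/
theorem quasiPoly_add_three_le {x : ℝ} (hx : 2 ≤ x) : 3 + quasiPoly x ≤ quasiPoly (x + 1) := by
  have hl : 1 ≤ Real.logb 2 x := by
    rw [Real.le_logb_iff_rpow_le (by norm_num) (by linarith)]; simpa using hx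
  have hl' : Real.logb 2 x ≤ Real.logb 2 (x + 1) :=
    Real.logb_le_logb_of_le (by norm_num) (by linarith) (by linarith)
  have split : ∀ y : ℝ, 0 < y →
      y ^ (2 * Real.logb 2 x) = y ^ (2 * Real.logb 2 x - 2) * y ^ 2 := fun y hy => by
    rw [← Real.rpow_two, ← Real.rpow_add hy]; congr 1; ring
  have h1 : (1 : ℝ) ≤ x ^ (2 * Real.logb 2 x - 2) := Real.one_le_rpow (by linarith) (by linarith)
  have h2 : x ^ (2 * Real.logb 2 x - 2) ≤ (x + 1) ^ (2 * Real.logb 2 x - 2) :=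
    Real.rpow_le_rpow (by linarith) (by linarith) (by linarith)
  calc 3 + quasiPoly x ≤ x ^ (2 * Real.logb 2 x - 2) * (x + 1) ^ 2 := by
        rw [quasiPoly, split x (by linarith)]
        nlinarith
    _ ≤ (x + 1) ^ (2 * Real.logb 2 x - 2) * (x + 1) ^ 2 := by gcongr
    _ = (x + 1) ^ (2 * Real.logb 2 x) := (split _ (by linarith)).symm
    _ ≤ quasiPoly (x + 1) := Real.rpow_le_rpow_of_exponent_le (by linarith) (by linarith)

namespace Stacking

theorem count_universal_le (m : ℕ) : ((universal m).count : ℝ) ≤ quasiPoly (m + 1) := by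
  induction m using Nat.strong_induction_on with
  | _ m ih =>
  cases m with
  | zero => simp [count_universal_zero, quasiPoly_one]
  | succ m =>
    have h1 := ih (m / 2) (by omega)
    have hdiv : ((m / 2 : ℕ) : ℝ) ≤ m / 2 := Nat.cast_div_le
    have hm : (0 : ℝ) ≤ m := Nat.cast_nonneg m
    have hd0 : (0 : ℝ) ≤ ((m / 2 : ℕ) : ℝ) := Nat.cast_nonneg _
    have h2 : quasiPoly ((m / 2 : ℕ) + 1) ≤ quasiPoly ((m + 2) / 2) :=
      quasiPoly_mono (by linarith) (by linarith)
    have h3 : quasiPoly ((m + 1 : ℕ) + 1) =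
        4 * ((m + 2 : ℝ) / 2) ^ 4 * quasiPoly ((m + 2) / 2) := by
      rw [← quasiPoly_two_mul (by positivity)]; congr 1; push_cast; ring
    have h4 : 1 ≤ quasiPoly ((m + 2 : ℝ) / 2) := one_le_quasiPoly (by linarith)
    have h5 : 1 + 2 * (m + 1 : ℝ) ^ 2 ≤ 4 * ((m + 2 : ℝ) / 2) ^ 4 := by
      nlinarith [pow_nonneg hm 2, pow_nonneg hm 3, pow_nonneg hm 4]
    rw [h3, count_universal_succ]
    push_cast
    calc 1 + 2 * (m + 1 : ℝ) ^ 2 * (universal (m / 2)).count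
        ≤ quasiPoly ((m + 2) / 2) + 2 * (m + 1 : ℝ) ^ 2 * quasiPoly ((m + 2) / 2) := by
          gcongr
          exact h1.trans h2
      _ = (1 + 2 * (m + 1 : ℝ) ^ 2) * quasiPoly ((m + 2) / 2) := by ring
      _ ≤ _ := by gcongr

theorem three_add_count_universal_le (m : ℕ) :
    ((3 + (universal m).count : ℕ) : ℝ) ≤ quasiPoly (m + 2 : ℕ) := by
  cases m with
  | zero => rw [count_universal_zero]; norm_num [quasiPoly_two]
  | succ m =>
    have h1 := count_universal_le (m + 1)
    have h2 := quasiPoly_add_three_le (x := (m + 1 : ℕ) + 1)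
      (by push_cast; linarith [Nat.cast_nonneg (α := ℝ) m])
    rw [show ((m + 1 + 2 : ℕ) : ℝ) = ((m + 1 : ℕ) + 1 : ℝ) + 1 by push_cast; ring]
    push_cast at *
    linarith

/-- Halving m lowers k by one and yields a factor of at least 2 to the new k; these exponents sum to
the binomial coefficient. -/
theorem le_count_universal (k m : ℕ) (h : 2 ^ k ≤ m + 1) :
    2 ^ (k.choose 2) ≤ (universal m).count := by
  induction k generalizing m with
  | zero =>
    cases m with
    | zero => simp [count_universal_zero]
    | succ m => rw [count_universal_succ]; simp
  | succ k ih =>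
    obtain ⟨m, rfl⟩ : ∃ m', m = m' + 1 := ⟨m - 1, by have := Nat.one_le_two_pow (n := k); omega⟩
    have h1 := ih (m / 2) (by omega)
    have h2 : 2 ^ k ≤ m + 1 := by have := Nat.one_le_two_pow (n := k); omega
    rw [count_universal_succ, Nat.choose_succ_succ' k 1, Nat.choose_one_right, pow_add]
    calc 2 ^ k * 2 ^ k.choose 2 ≤ (m + 1) * (universal (m / 2)).count := Nat.mul_le_mul h2 h1
      _ ≤ 2 * (m + 1) ^ 2 * (universal (m / 2)).count := by
        gcongr
        nlinarith
      _ ≤ _ := Nat.le_add_left _ _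

theorem log_sq_le_log_count_universal (m : ℕ) (hm : 4 ≤ m + 1) :
    Real.log (m + 2 : ℕ) ^ 2 ≤ 9 * Real.log 2 * Real.log (3 + (universal m).count : ℕ) := by
  set k := Nat.log 2 (m + 1)
  have hk2 : 2 ≤ k := (Nat.le_log_iff_pow_le (by norm_num) (by omega)).mpr (by simpa using hm)
  have hlow : 2 ^ k ≤ m + 1 := Nat.pow_log_le_self 2 (by omega)
  have hup : m + 2 ≤ 2 ^ (k + 1) := Nat.lt_pow_succ_log_self (by norm_num) (m + 1)
  have hcount := le_count_universal k m hlow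
  have hlog2 : 0 < Real.log 2 := Real.log_pos (by norm_num)
  have h1 : Real.log (m + 2 : ℕ) ≤ (k + 1) * Real.log 2 := by
    have : ((m + 2 : ℕ) : ℝ) ≤ 2 ^ (k + 1) := by exact_mod_cast hup
    calc Real.log (m + 2 : ℕ) ≤ Real.log (2 ^ (k + 1)) := Real.log_le_log (by positivity) this
      _ = _ := by rw [Real.log_pow]; push_cast; ring
  have h2 : (k * (k - 1) / 2 : ℝ) * Real.log 2 ≤ Real.log (3 + (universal m).count : ℕ) := by
    have : (2 : ℝ) ^ (k.choose 2) ≤ (3 + (universal m).count : ℕ) := by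
      exact_mod_cast hcount.trans (Nat.le_add_left _ _)
    calc (k * (k - 1) / 2 : ℝ) * Real.log 2 = Real.log (2 ^ (k.choose 2)) := by
          rw [Real.log_pow, Nat.cast_choose_two]
      _ ≤ _ := Real.log_le_log (by positivity) this
  have h0 : 0 ≤ Real.log (m + 2 : ℕ) := Real.log_natCast_nonneg _
  have hk : (2 : ℝ) ≤ k := by exact_mod_cast hk2
  calc Real.log (m + 2 : ℕ) ^ 2 ≤ ((k + 1) * Real.log 2) ^ 2 := by gcongr
    _ = Real.log 2 ^ 2 * (k + 1) ^ 2 := by ring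
    -- The constant 9 gives equality at k = 2.
    _ ≤ Real.log 2 ^ 2 * (9 * (k * (k - 1) / 2)) := by
      gcongr
      nlinarith
    _ = 9 * Real.log 2 * ((k * (k - 1) / 2 : ℝ) * Real.log 2) := by ring
    _ ≤ _ := by gcongr

end Stacking

theorem mainTheorem7 :
    ∃ (N : ℕ → ℕ) (G : (n : ℕ) → SimpleGraph (Fin (N n))),
      (∀ n : ℕ, 1 ≤ n →
        IsPlanar (G n) ∧
        (∀ H : SimpleGraph (Fin n), IsOuterplanar H → SimpleGraph.IsContained H (G n)) ∧
        (N n : ℝ) ≤ (n : ℝ) ^ (2 * Real.logb 2 (n : ℝ))) ∧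
      ∃ f : ℕ → ℝ, (f =Θ[atTop] fun n : ℕ => Real.log (n : ℝ)) ∧
        ∀ n : ℕ, 1 ≤ n → (N n : ℝ) = (n : ℝ) ^ f n := by
  -- The upper bound equals 1 at n = 1, so a single vertex is used there; the value at n = 0 is
  -- immaterial.
  have hex : ∀ n : ℕ, ∃ (M : ℕ) (G : SimpleGraph (Fin M)), (1 ≤ n → IsPlanar G ∧
      ∀ H : SimpleGraph (Fin n), IsOuterplanar H → SimpleGraph.IsContained H G) ∧
      (n = 1 → M = 1) ∧ ∀ m, n = m + 2 → M = 3 + (Stacking.universal m).count := by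
    intro n
    obtain hn | rfl | ⟨m, rfl⟩ : n = 0 ∨ n = 1 ∨ ∃ m, n = m + 2 := by
      rcases n with - | - | m
      · exact Or.inl rfl
      · exact Or.inr (Or.inl rfl)
      · exact Or.inr (Or.inr ⟨m, rfl⟩)
    · exact ⟨0, ⊥, by omega, by omega, by omega⟩
    · refine ⟨1, ⊥, fun _ => ⟨isPlanar_of_segments (fun _ => 0)
        (Function.injective_of_subsingleton _) ∅ (fun u v h => h.elim) (by simp) (by simp),
        fun H _ => ?_⟩, fun _ => rfl, by omega⟩
      exact ⟨⟨⟨id, fun {u v} h => absurd (Subsingleton.elim u v) h.ne⟩, Function.injective_id⟩⟩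
    · obtain ⟨G, hG⟩ := Stacking.exists_universal_graph m
      refine ⟨_, G, fun _ => hG, by omega, fun m' hm' => ?_⟩
      obtain rfl : m = m' := by omega
      rfl
  choose N G hG h1 h2 using hex
  have hle : ∀ n : ℕ, 1 ≤ n → (N n : ℝ) ≤ (n : ℝ) ^ (2 * Real.logb 2 (n : ℝ)) := by
    intro n hn
    obtain rfl | ⟨m, rfl⟩ : n = 1 ∨ ∃ m, n = m + 2 := by
      rcases hn.eq_or_lt with rfl | hn
      · exact Or.inl rfl
      · exact Or.inr ⟨n - 2, by omega⟩
    · simp [h1 1 rfl]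
    · rw [h2 _ m rfl]
      exact Stacking.three_add_count_universal_le m
  have hpos : ∀ n : ℕ, 2 ≤ n → (1 : ℝ) ≤ N n := by
    intro n hn
    rw [h2 n (n - 2) (by omega)]
    exact_mod_cast by omega
  refine ⟨N, G, fun n hn => ⟨(hG n hn).1, (hG n hn).2, hle n hn⟩,
    fun n => Real.logb n (N n), ⟨?_, ?_⟩, fun n hn => ?_⟩
  · refine IsBigO.of_bound (2 / Real.log 2) ?_
    filter_upwards [eventually_ge_atTop 2] with n hn
    have hn1 : (1 : ℝ) < n := by exact_mod_cast hn
    have hN := hpos n hn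
    rw [Real.norm_of_nonneg (Real.logb_nonneg hn1 hN), Real.norm_of_nonneg (Real.log_nonneg hn1.le),
      Real.logb_le_iff_le_rpow hn1 (by linarith)]
    refine (hle n (by omega)).trans_eq ?_
    congr 1
    rw [Real.logb]
    ring
  · refine IsBigO.of_bound (9 * Real.log 2) ?_
    -- For n = m + 2 this is 4 ≤ m + 1, as the lower bound requires.
    filter_upwards [eventually_ge_atTop 5] with n hn
    obtain ⟨m, rfl⟩ : ∃ m, n = m + 2 := ⟨n - 2, by omega⟩
    have hn1 : (1 : ℝ) < (m + 2 : ℕ) := by exact_mod_cast (by omega : 1 < m + 2)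
    have hlog : 0 < Real.log (m + 2 : ℕ) := Real.log_pos hn1
    rw [Real.norm_of_nonneg (Real.logb_nonneg hn1 (hpos _ (by omega))),
      Real.norm_of_nonneg hlog.le, Real.logb, ← mul_div_assoc, le_div_iff₀ hlog, ← sq,
      h2 _ m rfl]
    exact Stacking.log_sq_le_log_count_universal m (by omega)
  · rcases hn.eq_or_lt with rfl | hn
    · simp [h1 1 rfl]
    · have hn1 : (1 : ℝ) < n := by exact_mod_cast hn
      exact (Real.rpow_logb (by linarith) hn1.ne' (by linarith [hpos n hn])).symm
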